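/- Let $(\Omega,\mathcal F,\mathbb P)$ be a probability space, $\Sigma$ the set of all sub-$\sigma$-algebras of $\mathcal F$, $\mathcal X=L^1(\Omega,\mathcal F,\mathbb P)$ (random variables that are $\mathbb P$-a.s. equal are identified, and all (in)equalities, infima and measurability statements are understood up to $\mathbb P$-null sets), and let $n\ge 3$, $[n]=\{1,\dots,n\}$. For $\boldsymbol X=(X_1,\dots,X_n)\in\mathcal X^n$, $S\in\mathcal X$ and $\mathcal G\in\Sigma$ put $S^{\boldsymbol X}=\sum_{i=1}^n X_i$, $\mathcal G^S=\sigma(\mathcal G,\sigma(S))$ and $\mathcal G^{\boldsymbol X}=\mathcal G^{S^{\boldsymbol X}}$. For $Z\in\mathcal X$, $Z\boldsymbol e^{(i)}$ is the vector whose $i$-th component is $Z$ and whose other components are $0$. Write $X_m\downarrow X$ if $(X_m)_{m\in\mathbb N}$ is decreasing with $\inf_m X_m=X$. Let $H:\mathcal X^n\times\Sigma\to\mathcal X^n$, $(\boldsymbol X,\mathcal G)\mapsto H(\boldsymbol X|\mathcal G)=(H_1(\boldsymbol X|\mathcal G),\dots,H_n(\boldsymbol X|\mathcal G))$, be an arbitrary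 mapping, and write $\mathcal C_{i,j}^{\boldsymbol X,\mathcal G}(H)=X_i+X_j-H_i(\boldsymbol X|\mathcal G)-H_j(\boldsymbol X|\mathcal G)$. Then the following are equivalent. (i) $H$ is an allocation mechanism, i.e. $\sum_{i=1}^n H_i(\boldsymbol X|\mathcal G)\le S^{\boldsymbol X}$ for all $\boldsymbol X\in\mathcal X^n$, $\mathcal G\in\Sigma$, and $H$ satisfies, for all $\mathcal G\in\Sigma$, $\boldsymbol X\in\mathcal X^n$ and $i,j\in[n]$, the Allocation Axioms - (IF) $X_i\ge X_j$ implies $H_i(\boldsymbol X|\mathcal G)\ge H_j(\boldsymbol X|\mathcal G)$; - (AA) $H_i(X_{\pi(1)},\dots,X_{\pi(n)}|\mathcal G)=H_{\pi(i)}(\boldsymbol X|\mathcal G)$ for every permutation $\pi$ of $[n]$; - (OA) $H_k(\boldsymbol X-X_j\boldsymbol e^{(j)}+X_j\boldsymbol e^{(i)}|\mathcal G)=H_k(\boldsymbol X|\mathcal G)$ for all $k\in[n]\setminus\{i,j\}$; - (FP) if $X_j=0$, $Z\in\mathcal X$ and $\boldsymbol Y=\boldsymbol X+Z\boldsymbol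 e^{(j)}-Z\boldsymbol e^{(i)}$, then $\mathcal C_{i,j}^{\boldsymbol Y,\mathcal G}(H)\ge\mathcal C_{i,j}^{\boldsymbol X,\mathcal G}(H)$; - (SI) if $X_j=0$, $\alpha\in[0,1]$ and $\boldsymbol Y=\boldsymbol X+\alpha X_i\boldsymbol e^{(j)}-\alpha X_i\boldsymbol e^{(i)}$, then $H_j(\boldsymbol Y|\mathcal G)=\alpha H_i(\boldsymbol X|\mathcal G)$; and the Allocation Properties - (ZP) $X_i=0$ implies $H_i(\boldsymbol X|\mathcal G)=0$; - (IA) $H_i(\boldsymbol X|\mathcal G)$ is $\mathcal G^{\boldsymbol X}$-measurable; - (IB) if $X_i$ is $\mathcal G^{\boldsymbol X}$-measurable, then $H_i(\boldsymbol X|\mathcal G)=X_i$; - (CA) if $X_m\downarrow X$ in $\mathcal X$ and $|X_m|\le Y$ for some $Y\in\mathcal X$ and all $m$, then for all $S\in\mathcal X$ and $i\ne j$, $H_i(X_m\boldsymbol e^{(i)}+(S-X_m)\boldsymbol e^{(j)}|\mathcal G)\downarrow H_i(X\boldsymbol e^{(i)}+(S-X)\boldsymbol e^{(j)}|\mathcal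 G)$. (ii) $H$ is a robust conditional mean allocation mechanism with sets of measures that are common to all agents and compatible with $\mathbb P$. That is, there are sets $\mathcal Q_i(S,\mathcal G)$ of probability measures on $(\Omega,\mathcal F)$, for $i\in[n]$, $S\in\mathcal X$, $\mathcal G\in\Sigma$, such that - for all $\boldsymbol X\in\mathcal X^n$, $\mathcal G\in\Sigma$ and $i\in[n]$, the variable $X_i$ is integrable under every $Q\in\mathcal Q_i(S^{\boldsymbol X},\mathcal G)$, and $$H_i(\boldsymbol X|\mathcal G)=\inf_{Q\in\mathcal Q_i(S^{\boldsymbol X},\mathcal G)}\mathbb E^{Q}\big[X_i\,\big|\,\mathcal G^{\boldsymbol X}\big],$$ where the infimum is taken in the $\mathbb P$-a.s. order (essential infimum); - $\mathcal Q_i(S,\mathcal G)=\mathcal Q_j(S,\mathcal G)$ for all $i,j\in[n]$, $S\in\mathcal X$, $\mathcal G\in\Sigma$; - every $Q\in\mathcal Q_i(S,\mathcal G)$ satisfies $Q\ll\mathbb P$ and $Q(A)=\mathbb P(A)$ for all $A\in\mathcal G^S$, for all $i\in[n]$, $S\in\mathcal X$, $\mathcal G\in\Sigma$. -/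

import Mathlib

open MeasureTheory
open scoped ENNReal

noncomputable section

namespace Alloc

/-- The space `𝒳 = L¹(Ω, 𝓕, P)` of integrable random variables, modulo `P`-a.s. equality, with the
`P`-a.s. order. -/
abbrev RV {Ω : Type*} [MeasurableSpace Ω] (P : Measure Ω) : Type _ := Lp ℝ 1 P

/-- The set of all sub-σ-algebras of the ambient σ-algebra. -/
abbrev SubSigma (Ω : Type*) [mΩ : MeasurableSpace Ω] : Type _ := {m : MeasurableSpace Ω // m ≤ mΩ}

/-- A mapping `H : 𝒳ⁿ × Σ → 𝒳ⁿ`; `H X G i` is the `i`-th component `H_i(X | G)`. -/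
abbrev Mapping {Ω : Type*} [MeasurableSpace Ω] (P : Measure Ω) (n : ℕ) : Type _ :=
  (Fin n → RV P) → SubSigma Ω → (Fin n → RV P)

/-- The aggregate endowment `S^X = ∑ i, X_i`. -/
def total {Ω : Type*} [MeasurableSpace Ω] {P : Measure Ω} {n : ℕ} (X : Fin n → RV P) : RV P :=
  ∑ i, X i

/-- `G^S = σ(G, σ(S))`. (A representative of the class `S` is used; another one changes `G^S`
only by `P`-null sets, and everything below is insensitive to this.) -/
def augment {Ω : Type*} [MeasurableSpace Ω] {P : Measure Ω} (G : SubSigma Ω) (S : RV P) :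
    SubSigma Ω :=
  ⟨G.1 ⊔ MeasurableSpace.comap (S : Ω → ℝ) (borel ℝ),
    sup_le G.2 (by
      rw [← BorelSpace.measurable_eq (α := ℝ)]
      exact (Lp.stronglyMeasurable S).measurable.comap_le)⟩

/-- `σ(Y) ⊆ G` for a random variable `Y` taken up to `P`-a.s. equality: `Y` has a `G`-measurable
version. -/
def IsMeasurableFor {Ω : Type*} [MeasurableSpace Ω] {P : Measure Ω} (Y : RV P) (G : SubSigma Ω) :
    Prop :=
  AEStronglyMeasurable[G.1] (Y : Ω → ℝ) P

/-- `X_m ↓ X`: the sequence is decreasing and its infimum, in the `P`-a.s. order, is `X`. -/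
def DecreasesTo {Ω : Type*} [MeasurableSpace Ω] {P : Measure Ω} (X : ℕ → RV P) (Y : RV P) : Prop :=
  Antitone X ∧ IsGLB (Set.range X) Y

/-- Membership in the set of allocation mechanisms: `H(X | G)` is a sub-allocation of `S^X`. -/
def IsAllocationMechanism {Ω : Type*} [MeasurableSpace Ω] {P : Measure Ω} {n : ℕ}
    (H : Mapping P n) : Prop :=
  ∀ (X : Fin n → RV P) (G : SubSigma Ω), ∑ i, H X G i ≤ total X

/-- The local frictional cost of the pair `(i, j)`. -/
def localCost {Ω : Type*} [MeasurableSpace Ω] {P : Measure Ω} {n : ℕ}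
    (H : Mapping P n) (X : Fin n → RV P) (G : SubSigma Ω) (i j : Fin n) : RV P :=
  X i + X j - H X G i - H X G j

/-! ### Allocation Axioms -/

/-- IF. -/
def InternalFairness {Ω : Type*} [MeasurableSpace Ω] {P : Measure Ω} {n : ℕ}
    (H : Mapping P n) : Prop :=
  ∀ (G : SubSigma Ω) (X : Fin n → RV P) (i j : Fin n), X j ≤ X i → H X G j ≤ H X G i

/-- AA. -/
def AgentAnonymity {Ω : Type*} [MeasurableSpace Ω] {P : Measure Ω} {n : ℕ}
    (H : Mapping P n) : Prop :=
  ∀ (π : Equiv.Perm (Fin n)) (G : SubSigma Ω) (X : Fin n → RV P) (i : Fin n),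
    H (fun k => X (π k)) G i = H X G (π i)

/-- OA. -/
def OperationalAnonymity {Ω : Type*} [MeasurableSpace Ω] {P : Measure Ω} {n : ℕ}
    (H : Mapping P n) : Prop :=
  ∀ (G : SubSigma Ω) (X : Fin n → RV P) (i j k : Fin n), k ≠ i → k ≠ j →
    H (X - Pi.single j (X j) + Pi.single i (X j)) G k = H X G k

/-- FP. -/
def FrictionalParticipation {Ω : Type*} [MeasurableSpace Ω] {P : Measure Ω} {n : ℕ}
    (H : Mapping P n) : Prop :=
  ∀ (G : SubSigma Ω) (Z : RV P) (i j : Fin n) (X : Fin n → RV P), X j = 0 →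
    localCost H X G i j ≤ localCost H (X + Pi.single j Z - Pi.single i Z) G i j

/-- SI. -/
def ScaleInvariance {Ω : Type*} [MeasurableSpace Ω] {P : Measure Ω} {n : ℕ}
    (H : Mapping P n) : Prop :=
  ∀ (G : SubSigma Ω) (i j : Fin n) (α : ℝ) (X : Fin n → RV P), 0 ≤ α → α ≤ 1 → X j = 0 →
    H (X + Pi.single j (α • X i) - Pi.single i (α • X i)) G j = α • H X G i

/-- The Allocation Axioms IF, AA, OA, FP, SI. -/
structure AllocationAxioms {Ω : Type*} [MeasurableSpace Ω] {P : Measure Ω} {n : ℕ}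
    (H : Mapping P n) : Prop where
  internalFairness : InternalFairness H
  agentAnonymity : AgentAnonymity H
  operationalAnonymity : OperationalAnonymity H
  frictionalParticipation : FrictionalParticipation H
  scaleInvariance : ScaleInvariance H

/-! ### Allocation Properties -/

/-- ZP. -/
def ZeroPreserving {Ω : Type*} [MeasurableSpace Ω] {P : Measure Ω} {n : ℕ}
    (H : Mapping P n) : Prop :=
  ∀ (G : SubSigma Ω) (X : Fin n → RV P) (i : Fin n), X i = 0 → H X G i = 0

/-- IA. -/
def InformationAnonymity {Ω : Type*} [MeasurableSpace Ω] {P : Measure Ω} {n : ℕ}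
    (H : Mapping P n) : Prop :=
  ∀ (G : SubSigma Ω) (X : Fin n → RV P) (i : Fin n),
    IsMeasurableFor (H X G i) (augment G (total X))

/-- IB. -/
def InformationBacktracking {Ω : Type*} [MeasurableSpace Ω] {P : Measure Ω} {n : ℕ}
    (H : Mapping P n) : Prop :=
  ∀ (G : SubSigma Ω) (i : Fin n) (X : Fin n → RV P),
    IsMeasurableFor (X i) (augment G (total X)) → H X G i = X i

/-- CA. -/
def ContinuityFromAbove {Ω : Type*} [MeasurableSpace Ω] {P : Measure Ω} {n : ℕ}
    (H : Mapping P n) : Prop :=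
  ∀ (X : ℕ → RV P) (X' Y : RV P), DecreasesTo X X' → (∀ m, |X m| ≤ Y) →
    ∀ (S : RV P) (G : SubSigma Ω) (i j : Fin n), i ≠ j →
      DecreasesTo (fun m => H (Pi.single i (X m) + Pi.single j (S - X m)) G i)
        (H (Pi.single i X' + Pi.single j (S - X')) G i)

/-- The Allocation Properties ZP, IA, IB, CA. -/
structure AllocationProperties {Ω : Type*} [MeasurableSpace Ω] {P : Measure Ω} {n : ℕ}
    (H : Mapping P n) : Prop where
  zeroPreserving : ZeroPreserving H
  informationAnonymity : InformationAnonymity H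
  informationBacktracking : InformationBacktracking H
  continuityFromAbove : ContinuityFromAbove H

/-! ### Robust conditional mean allocation mechanisms -/

/-- The `P`-class of (a `G`-measurable version of) the conditional expectation `E^Q[X | G]`.
If `Q ≪ P`, `Q = P` on `G` and `X` is `Q`-integrable, it does not depend on any choice of
versions. -/
def condMean {Ω : Type*} [MeasurableSpace Ω] {P : Measure Ω} (Q : ProbabilityMeasure Ω)
    (X : RV P) (G : SubSigma Ω) : Ω →ₘ[P] ℝ :=
  AEEqFun.mk ((Q : Measure Ω)[(X : Ω → ℝ) | G.1])
    (stronglyMeasurable_condExp.mono G.2).aestronglyMeasurable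

/-- The probability measures `Q` with `Q ≪ P` and `Q = P` on `G`. -/
def compatible {Ω : Type*} [MeasurableSpace Ω] (P : Measure Ω) (G : SubSigma Ω) :
    Set (ProbabilityMeasure Ω) :=
  {Q | (Q : Measure Ω) ≪ P ∧ ∀ A : Set Ω, MeasurableSet[G.1] A → (Q : Measure Ω) A = P A}

/-- `H` is the robust conditional mean allocation mechanism given by the sets of probability
measures `𝒬 i S G`: for all `X`, `G` and `i`, the variable `X_i` is integrable under every
`Q ∈ 𝒬 i S^X G` and `H_i(X | G) = inf {E^Q[X_i | G^X] : Q ∈ 𝒬 i S^X G}`, an infimum in the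
`P`-a.s. order on classes of random variables. -/
def IsRobustConditionalMean {Ω : Type*} [MeasurableSpace Ω] {P : Measure Ω} {n : ℕ}
    (H : Mapping P n) (𝒬 : Fin n → RV P → SubSigma Ω → Set (ProbabilityMeasure Ω)) : Prop :=
  ∀ (X : Fin n → RV P) (G : SubSigma Ω) (i : Fin n),
    (∀ Q ∈ 𝒬 i (total X) G, Integrable (X i : Ω → ℝ) (Q : Measure Ω)) ∧
      IsGLB ((fun Q => condMean Q (X i) (augment G (total X))) '' 𝒬 i (total X) G)
        (H X G i : Ω →ₘ[P] ℝ)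

end Alloc

end

/-!
The axioms force `H_i(X | G)` to be a function of `X_i`, `S^X` and `G` alone: operational anonymity
lets all agents other than `i` merge into one, and agent anonymity makes the result independent of
`i` (`OperationalAnonymity.eq_twoAgent`). For fixed `S` and `G` the resulting map `φ` on `L¹` is a
*conditional coherent utility* for `G^S` (`CondUtility`): monotone by IF, superadditive by FP,
positively homogeneous by SI, with `G^S`-measurable values, the identity on `G^S`-measurable
variables, and continuous from above. Placing `Z`, `W` and `S - Z - W` with three agents is what
needs `n ≥ 3`. Conversely, every family of conditional coherent utilities satisfies all axioms
(`IsUtilityBased`), so the theorem reduces to a statement about one map `ψ : L¹ → L¹` and one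
sub-σ-algebra `m`: `ψ` is a conditional coherent utility iff it is an essential infimum of
conditional means `E^Q[· | m]` over measures `Q ≪ P` that agree with `P` on `m`.

If `ψ` is such an infimum, the listed properties are inherited from conditional means
(`condUtility_of_isGLB`); measurability of an infimum `h` follows because `E^P[h | m]` is again a
lower bound, hence below `h`, with the same integral.

If `ψ` is a conditional coherent utility, take all `Q` that agree with `P` on `m` and satisfy
`E^P[ψ X] ≤ E^Q[X]` for every `X` (`representing`). Locality of `ψ` (`CondUtility.ae_le_of_le_add`)
upgrades this inequality to `ψ X ≤ E^Q[X | m]`. For a given `Y`, the Hahn-Banach theorem yields a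
linear `ℓ ≥ E^P ∘ ψ` with equality at `Y`. It is positive, hence bounded on `L¹`, hence integration
against a measure `Q` (`exists_measure_of_positive`), and `Q = P` on `m` because `ψ` fixes
`m`-measurable variables. Then `ψ Y ≤ E^Q[Y | m]` with equal integrals, so the infimum is attained.
-/

noncomputable section

namespace Alloc

variable {Ω : Type*} [mΩ : MeasurableSpace Ω] {P : Measure Ω}

/-! ### Positive linear functionals on `L¹` -/

section PositiveFunctional

theorem rv_smul_le_smul {c : ℝ} (hc : 0 ≤ c) {X Y : RV P} (h : X ≤ Y) : c • X ≤ c • Y := by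
  rw [← Lp.coeFn_le] at h ⊢
  filter_upwards [h, Lp.coeFn_smul c X, Lp.coeFn_smul c Y] with ω h h1 h2
  rw [h1, h2]
  exact mul_le_mul_of_nonneg_left h hc

/-- A positive linear functional on `L¹` is automatically bounded. Otherwise there are nonnegative
`f k` with `ℓ (f k) > 4 ^ k ‖f k‖`, and `ℓ` would exceed every `2 ^ k` at
`∑ f k / (2 ^ k ‖f k‖)`. -/
theorem exists_bound_of_positive (ℓ : RV P →ₗ[ℝ] ℝ) (hℓ : ∀ Y, 0 ≤ Y → 0 ≤ ℓ Y) :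
    ∃ C : ℝ, 0 ≤ C ∧ ∀ Y, |ℓ Y| ≤ C * ‖Y‖ := by
  have mono : ∀ {X Y : RV P}, X ≤ Y → ℓ X ≤ ℓ Y := fun {X Y} h => by
    have := hℓ (Y - X) (sub_nonneg.2 h)
    rw [map_sub] at this
    linarith
  have key : ∃ C : ℝ, 0 ≤ C ∧ ∀ Y : RV P, 0 ≤ Y → ℓ Y ≤ C * ‖Y‖ := by
    by_contra! hcon
    choose! f hf0 hf using fun k : ℕ => hcon ((4 : ℝ) ^ k) (by positivity)
    have hnorm : ∀ k, 0 < ‖f k‖ := fun k => by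
      rcases (norm_nonneg (f k)).eq_or_lt with h | h
      · have h0 : f k = 0 := norm_eq_zero.1 h.symm
        have := hf k
        rw [h0] at this
        simp at this
      · exact h
    let g : ℕ → RV P := fun k => ((2 : ℝ) ^ k * ‖f k‖)⁻¹ • f k
    have hg0 : ∀ k, 0 ≤ g k := fun k => by
      have := rv_smul_le_smul (c := ((2 : ℝ) ^ k * ‖f k‖)⁻¹) (by positivity) (hf0 k)
      rwa [smul_zero] at this
    have hgn : ∀ k, ‖g k‖ = (1 / 2 : ℝ) ^ k := fun k => by
      have := hnorm k
      simp only [g, norm_smul, norm_inv, norm_mul, norm_pow, norm_norm, Real.norm_ofNat]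
      rw [mul_inv, mul_assoc, inv_mul_cancel₀ this.ne', mul_one, one_div, inv_pow]
    have hgs : Summable g := by
      refine Summable.of_norm ?_
      simp only [hgn]
      exact summable_geometric_two
    have hgℓ : ∀ k, (2 : ℝ) ^ k ≤ ℓ (g k) := fun k => by
      have h1 := hnorm k
      have h2 := hf k
      simp only [g, map_smul, smul_eq_mul]
      rw [inv_mul_eq_div, le_div_iff₀ (by positivity)]
      calc (2 : ℝ) ^ k * (2 ^ k * ‖f k‖) = 4 ^ k * ‖f k‖ := by
            rw [← mul_assoc, ← mul_pow]; norm_num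
        _ ≤ _ := h2.le
    have hle : ∀ k, (2 : ℝ) ^ k ≤ ℓ (∑' k, g k) := fun k =>
      (hgℓ k).trans (mono (hgs.le_tsum k fun j _ => hg0 j))
    obtain ⟨k, hk⟩ := pow_unbounded_of_one_lt (ℓ (∑' k, g k)) (one_lt_two (α := ℝ))
    exact absurd (hle k) (not_le.2 hk)
  obtain ⟨C, hC, h⟩ := key
  refine ⟨C, hC, fun Y => ?_⟩
  have h1 := h |Y| (abs_nonneg Y)
  rw [norm_abs_eq_norm] at h1
  refine abs_le.2 ⟨?_, (mono (le_abs_self Y)).trans h1⟩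
  have h2 := mono (neg_le_abs Y)
  rw [map_neg] at h2
  linarith

/-- The class of the indicator function of `A`. -/
def ind (P : Measure Ω) [IsFiniteMeasure P] {A : Set Ω} (hA : MeasurableSet A) : RV P :=
  indicatorConstLp 1 hA (measure_ne_top P A) 1

variable [IsFiniteMeasure P]

theorem ind_coeFn {A : Set Ω} (hA : MeasurableSet A) :
    (ind P hA : Ω → ℝ) =ᵐ[P] A.indicator fun _ => 1 :=
  indicatorConstLp_coeFn

theorem ind_nonneg {A : Set Ω} (hA : MeasurableSet A) : 0 ≤ ind P hA := by
  rw [← Lp.coeFn_nonneg]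
  filter_upwards [ind_coeFn (P := P) hA] with ω h
  rw [h]
  exact Set.indicator_nonneg (fun _ _ => zero_le_one) ω

theorem norm_ind {A : Set Ω} (hA : MeasurableSet A) : ‖ind P hA‖ = P.real A := by
  simp [ind, norm_indicatorConstLp one_ne_zero ENNReal.one_ne_top]

theorem ind_union {A B : Set Ω} (hA : MeasurableSet A) (hB : MeasurableSet B)
    (h : Disjoint A B) : ind P (hA.union hB) = ind P hA + ind P hB :=
  indicatorConstLp_disjoint_union hA hB _ _ h 1

/-- Countable additivity of `A ↦ ℓ(1_A)`. -/
theorem hasSum_ind (ℓ : RV P →L[ℝ] ℝ) (hℓ : ∀ Y, 0 ≤ Y → 0 ≤ ℓ Y) (f : ℕ → Set Ω)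
    (hf : ∀ i, MeasurableSet (f i)) (hd : Pairwise (Function.onFun Disjoint f)) :
    HasSum (fun i => ℓ (ind P (hf i))) (ℓ (ind P (MeasurableSet.iUnion hf))) := by
  rw [hasSum_iff_tendsto_nat_of_nonneg fun i => hℓ _ (ind_nonneg _)]
  have hfin : ∀ n, MeasurableSet (⋃ i ∈ Finset.range n, f i) := fun n =>
    Finset.measurableSet_biUnion _ fun i _ => hf i
  have hsum : ∀ n, ∑ i ∈ Finset.range n, ℓ (ind P (hf i)) = ℓ (ind P (hfin n)) := by
    intro n
    induction n with
    | zero =>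
      rw [Finset.sum_range_zero, ← map_zero ℓ]
      congr 1
      rw [← norm_eq_zero.1 ((norm_ind (hfin 0)).trans (by simp))]
    | succ n ih =>
      rw [Finset.sum_range_succ, ih, ← map_add, ← ind_union]
      · congr 2
        ext ω
        simp only [Set.mem_union, Set.mem_iUnion, Finset.mem_range, exists_prop,
          Nat.lt_succ_iff_lt_or_eq]
        constructor
        · rintro (⟨i, hi, h⟩ | h)
          exacts [⟨i, .inl hi, h⟩, ⟨n, .inr rfl, h⟩]
        · rintro ⟨i, hi | rfl, h⟩
          exacts [.inl ⟨i, hi, h⟩, .inr h]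
      · simp only [Set.disjoint_iUnion_left, Finset.mem_range]
        exact fun i hi => hd hi.ne
  simp only [hsum]
  refine (ℓ.continuous.tendsto _).comp ?_
  refine tendsto_indicatorConstLp_set ENNReal.one_ne_top ?_
  have hm : Monotone fun n => ⋃ i ∈ Finset.range n, f i := fun a b hab =>
    Set.biUnion_subset_biUnion_left fun i hi =>
      Finset.mem_range.2 ((Finset.mem_range.1 hi).trans_le hab)
  have hsub : ∀ n, (⋃ i ∈ Finset.range n, f i) ⊆ ⋃ i, f i := fun n =>
    Set.iUnion₂_subset fun i _ => Set.subset_iUnion f i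
  have hU : ⋃ n, ⋃ i ∈ Finset.range n, f i = ⋃ i, f i := by
    refine Set.Subset.antisymm (Set.iUnion_subset hsub) (Set.iUnion_subset fun i => ?_)
    exact fun ω h => Set.mem_iUnion.2 ⟨i + 1, Set.mem_biUnion (by simp) h⟩
  have ht := tendsto_measure_iUnion_atTop (μ := P) hm
  rw [hU] at ht
  have h0 := ENNReal.Tendsto.sub (tendsto_const_nhds (x := P (⋃ i, f i))) ht
    (.inl (measure_ne_top _ _))
  rw [tsub_self] at h0
  refine h0.congr fun n => ?_
  rw [symmDiff_comm, Set.symmDiff_def, Set.sdiff_eq_empty.2 (hsub n), Set.union_empty,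
    measure_sdiff (hsub n) (hfin n).nullMeasurableSet (measure_ne_top _ _)]
  rfl

/-- Every positive linear functional on `L¹(P)` is integration against a finite measure `Q` with a
bounded density. The measure is `A ↦ ℓ(1_A)`; both sides are continuous in `Y`, so they agree
because they agree on indicators. -/
theorem exists_measure_of_positive (ℓ : RV P →ₗ[ℝ] ℝ) (hℓ : ∀ Y, 0 ≤ Y → 0 ≤ ℓ Y) :
    ∃ (Q : Measure Ω) (C : ℝ), Q ≤ ENNReal.ofReal C • P ∧
      (∀ Y : RV P, Integrable Y Q) ∧ ∀ Y : RV P, ℓ Y = ∫ ω, Y ω ∂Q := by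
  obtain ⟨C, hC, hb⟩ := exists_bound_of_positive ℓ hℓ
  let L : RV P →L[ℝ] ℝ := ℓ.mkContinuous C hb
  have hL : ∀ Y, L Y = ℓ Y := fun Y => rfl
  let Q : Measure Ω := Measure.ofMeasurable (fun A hA => ENNReal.ofReal (L (ind P hA)))
    (by
      rw [norm_eq_zero.1 ((norm_ind (P := P) MeasurableSet.empty).trans (by simp))]
      simp)
    (fun f hf hd => by
      have h := hasSum_ind L hℓ f hf hd
      rw [← h.tsum_eq, ENNReal.ofReal_tsum_of_nonneg
        (fun i => (hL _).ge.trans' (hℓ _ (ind_nonneg _))) h.summable])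
  have hQ : ∀ (A : Set Ω) (hA : MeasurableSet A), Q A = ENNReal.ofReal (L (ind P hA)) :=
    fun A hA => Measure.ofMeasurable_apply A hA
  have hle : Q ≤ ENNReal.ofReal C • P := by
    refine Measure.le_iff.2 fun A hA => ?_
    rw [hQ A hA, Measure.smul_apply, smul_eq_mul, ← ofReal_measureReal (μ := P) (s := A),
      ← ENNReal.ofReal_mul hC, ← norm_ind hA]
    exact ENNReal.ofReal_le_ofReal ((le_abs_self _).trans (hb _))
  have hac : Q ≪ P := (Measure.absolutelyContinuous_of_le hle).trans
    (Measure.smul_absolutelyContinuous)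
  have hint : ∀ Y : RV P, Integrable Y Q := fun Y =>
    ((L1.integrable_coeFn Y).smul_measure ENNReal.ofReal_ne_top).mono_measure hle
  refine ⟨Q, C, hle, hint, fun Y => ?_⟩
  rw [← hL]
  have hcont : Continuous fun Y : RV P => ∫ ω, Y ω ∂Q := by
    let I : RV P →ₗ[ℝ] ℝ :=
      { toFun := fun Y => ∫ ω, Y ω ∂Q
        map_add' := fun X Y => by
          rw [← integral_add (hint X) (hint Y)]
          exact integral_congr_ae (hac.ae_le (Lp.coeFn_add X Y))
        map_smul' := fun c X => by
          rw [RingHom.id_apply, smul_eq_mul, ← integral_const_mul]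
          exact integral_congr_ae (hac.ae_le (Lp.coeFn_smul c X)) }
    obtain ⟨D, -, hD⟩ := exists_bound_of_positive I fun Y hY =>
      integral_nonneg_of_ae (hac.ae_le ((Lp.coeFn_nonneg Y).2 hY))
    exact (I.mkContinuous D hD).continuous
  induction Y using Lp.induction ENNReal.one_ne_top with
  | indicatorConst c hs hμs =>
    rename_i s
    rw [Lp.simpleFunc.coe_indicatorConst]
    have h1 : (indicatorConstLp 1 hs hμs.ne c : RV P) = c • ind P hs := by
      refine Lp.ext ?_
      filter_upwards [indicatorConstLp_coeFn (p := 1) (hs := hs) (hμs := hμs.ne) (c := c),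
        Lp.coeFn_smul c (ind P hs), ind_coeFn (P := P) hs] with ω h1 h2 h3
      rw [h1, h2, Pi.smul_apply, h3]
      by_cases h : ω ∈ s <;> simp [h]
    have h2 : ((c • ind P hs : RV P) : Ω → ℝ) =ᵐ[Q] s.indicator fun _ => c := by
      refine hac.ae_le ?_
      filter_upwards [Lp.coeFn_smul c (ind P hs), ind_coeFn (P := P) hs] with ω h1 h2
      rw [h1, Pi.smul_apply, h2]
      by_cases h : ω ∈ s <;> simp [h]
    rw [h1, integral_congr_ae h2, integral_indicator hs, integral_const, map_smul]
    simp only [MeasurableSet.univ, measureReal_restrict_apply, Set.univ_inter, smul_eq_mul]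
    rw [measureReal_def, hQ s hs,
      ENNReal.toReal_ofReal ((hL _).ge.trans' (hℓ _ (ind_nonneg hs))), mul_comm]
  | add hf hg hd h1 h2 =>
    rw [map_add, h1, h2, ← integral_add (hint _) (hint _)]
    exact (integral_congr_ae (hac.ae_le (Lp.coeFn_add _ _))).symm
  | isClosed => exact isClosed_eq L.continuous hcont

end PositiveFunctional

/-! ### Decreasing sequences -/

theorem ae_antitone {X : ℕ → RV P} (hX : Antitone X) : ∀ᵐ ω ∂P, Antitone fun k => X k ω := by
  have : ∀ᵐ ω ∂P, ∀ k, X (k + 1) ω ≤ X k ω :=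
    ae_all_iff.2 fun k => (Lp.coeFn_le _ _).2 (hX k.le_succ)
  exact this.mono fun ω h => antitone_nat_of_succ_le h

/-- The infimum of a decreasing sequence in the a.s. order is its a.e. pointwise limit. -/
theorem DecreasesTo.tendsto {X : ℕ → RV P} {X' : RV P} (h : DecreasesTo X X') :
    ∀ᵐ ω ∂P, Filter.Tendsto (fun k => X k ω) Filter.atTop (nhds (X' ω)) := by
  have hlb : ∀ᵐ ω ∂P, ∀ k, X' ω ≤ X k ω :=
    ae_all_iff.2 fun k => (Lp.coeFn_le _ _).2 (h.2.1 ⟨k, rfl⟩)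
  have hlim : ∀ᵐ ω ∂P, Filter.Tendsto (fun k => X k ω) Filter.atTop (nhds (⨅ k, X k ω)) := by
    filter_upwards [ae_antitone h.1, hlb] with ω h1 h2
    exact tendsto_atTop_ciInf h1 ⟨X' ω, by rintro _ ⟨k, rfl⟩; exact h2 k⟩
  have hle : ∀ᵐ ω ∂P, X' ω ≤ ⨅ k, X k ω := hlb.mono fun ω h => le_ciInf h
  have hge : ∀ᵐ ω ∂P, ∀ k, ⨅ k, X k ω ≤ X k ω := hlb.mono fun ω h k =>
    ciInf_le ⟨X' ω, by rintro _ ⟨k, rfl⟩; exact h k⟩ k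
  have hmeas : AEStronglyMeasurable (fun ω => ⨅ k, X k ω) P :=
    aestronglyMeasurable_of_tendsto_ae Filter.atTop
      (fun k => (Lp.stronglyMeasurable (X k)).aestronglyMeasurable) hlim
  have hint : Integrable (fun ω => ⨅ k, X k ω) P :=
    integrable_of_le_of_le hmeas hle (hge.mono fun ω h => h 0) (L1.integrable_coeFn X')
      (L1.integrable_coeFn (X 0))
  have hbd : hint.toL1 _ ≤ X' := h.2.2 <| by
    rintro _ ⟨k, rfl⟩
    rw [← Lp.coeFn_le]
    filter_upwards [hge, hint.coeFn_toL1] with ω h1 h2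
    exact h2.trans_le (h1 k)
  rw [← Lp.coeFn_le] at hbd
  filter_upwards [hbd, hint.coeFn_toL1, hle, hlim] with ω h1 h2 h3 h4
  rwa [le_antisymm h3 (h2.symm.trans_le h1)]

theorem decreasesTo_of_tendsto {X : ℕ → RV P} {X' : RV P} (hX : Antitone X)
    (h : ∀ᵐ ω ∂P, Filter.Tendsto (fun k => X k ω) Filter.atTop (nhds (X' ω))) :
    DecreasesTo X X' := by
  refine ⟨hX, ?_, fun W hW => ?_⟩
  · rintro _ ⟨k, rfl⟩
    rw [← Lp.coeFn_le]
    filter_upwards [ae_antitone hX, h] with ω h1 h2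
    exact h1.le_of_tendsto h2 k
  · have hW' : ∀ᵐ ω ∂P, ∀ k, W ω ≤ X k ω :=
      ae_all_iff.2 fun k => (Lp.coeFn_le _ _).2 (hW ⟨k, rfl⟩)
    rw [← Lp.coeFn_le]
    filter_upwards [hW', h] with ω h1 h2
    exact ge_of_tendsto' h2 h1

/-! ### Probability measures that agree with the reference measure on a sub-σ-algebra -/

section Compatible

variable {m : SubSigma Ω} {Q : ProbabilityMeasure Ω}

theorem trim_eq_of_mem_compatible (hQ : Q ∈ compatible P m) :
    (Q : Measure Ω).trim m.2 = P.trim m.2 := by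
  refine @Measure.ext _ m.1 _ _ fun A hA => ?_
  rw [trim_measurableSet_eq m.2 hA, trim_measurableSet_eq m.2 hA, hQ.2 A hA]

variable {f g : Ω → ℝ}

theorem ae_le_iff_of_mem_compatible (hQ : Q ∈ compatible P m) (hf : StronglyMeasurable[m.1] f)
    (hg : StronglyMeasurable[m.1] g) : f ≤ᵐ[(Q : Measure Ω)] g ↔ f ≤ᵐ[P] g := by
  rw [← hf.ae_le_trim_iff m.2 hg, ← hf.ae_le_trim_iff m.2 hg, trim_eq_of_mem_compatible hQ]

theorem ae_eq_iff_of_mem_compatible (hQ : Q ∈ compatible P m) (hf : StronglyMeasurable[m.1] f)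
    (hg : StronglyMeasurable[m.1] g) : f =ᵐ[(Q : Measure Ω)] g ↔ f =ᵐ[P] g := by
  rw [← hf.ae_eq_trim_iff m.2 hg, ← hf.ae_eq_trim_iff m.2 hg, trim_eq_of_mem_compatible hQ]

theorem integrable_of_mem_compatible (hQ : Q ∈ compatible P m) (hf : StronglyMeasurable[m.1] f)
    (hi : Integrable f (Q : Measure Ω)) : Integrable f P := by
  have := hi.trim m.2 hf
  rw [trim_eq_of_mem_compatible hQ] at this
  exact integrable_of_integrable_trim m.2 this

theorem setIntegral_eq_of_mem_compatible (hQ : Q ∈ compatible P m)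
    (hf : StronglyMeasurable[m.1] f) {A : Set Ω} (hA : MeasurableSet[m.1] A) :
    ∫ ω in A, f ω ∂(Q : Measure Ω) = ∫ ω in A, f ω ∂P := by
  rw [setIntegral_trim m.2 hf hA, setIntegral_trim m.2 hf hA, trim_eq_of_mem_compatible hQ]

theorem integral_eq_of_mem_compatible (hQ : Q ∈ compatible P m)
    (hf : StronglyMeasurable[m.1] f) : ∫ ω, f ω ∂(Q : Measure Ω) = ∫ ω, f ω ∂P := by
  simpa using setIntegral_eq_of_mem_compatible hQ hf MeasurableSet.univ

/-- For `m`-measurable functions, comparing integrals over the sets of `m` suffices. -/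
theorem ae_le_of_forall_setIntegral_le_trim (hf : StronglyMeasurable[m.1] f)
    (hg : StronglyMeasurable[m.1] g) (hfi : Integrable f P) (hgi : Integrable g P)
    (h : ∀ A, MeasurableSet[m.1] A → ∫ ω in A, f ω ∂P ≤ ∫ ω in A, g ω ∂P) : f ≤ᵐ[P] g := by
  rw [← hf.ae_le_trim_iff m.2 hg]
  refine ae_le_of_forall_setIntegral_le (hfi.trim m.2 hf) (hgi.trim m.2 hg) fun A hA _ => ?_
  rw [← setIntegral_trim m.2 hf hA, ← setIntegral_trim m.2 hg hA]
  exact h A hA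

/-! ### Conditional means -/

theorem condMean_coeFn (X : RV P) :
    (condMean Q X m : Ω → ℝ) =ᵐ[P] (Q : Measure Ω)[(X : Ω → ℝ) | m.1] :=
  AEEqFun.coeFn_mk _ _

theorem integrable_condExp_of_mem_compatible (hQ : Q ∈ compatible P m) (X : Ω → ℝ) :
    Integrable ((Q : Measure Ω)[X | m.1]) P :=
  integrable_of_mem_compatible hQ stronglyMeasurable_condExp integrable_condExp

theorem integral_condExp_of_mem_compatible (hQ : Q ∈ compatible P m) (X : Ω → ℝ) :
    ∫ ω, ((Q : Measure Ω)[X | m.1]) ω ∂P = ∫ ω, X ω ∂(Q : Measure Ω) := by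
  rw [← integral_eq_of_mem_compatible hQ stronglyMeasurable_condExp, integral_condExp m.2]

theorem condExp_mono_of_mem_compatible (hQ : Q ∈ compatible P m)
    (hint : ∀ X : RV P, Integrable X (Q : Measure Ω)) {X Y : RV P} (h : X ≤ Y) :
    (Q : Measure Ω)[(X : Ω → ℝ) | m.1] ≤ᵐ[P] (Q : Measure Ω)[(Y : Ω → ℝ) | m.1] :=
  (ae_le_iff_of_mem_compatible hQ stronglyMeasurable_condExp stronglyMeasurable_condExp).1
    (condExp_mono (m := m.1) (hint X) (hint Y) (hQ.1.ae_le ((Lp.coeFn_le X Y).2 h)))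

theorem condMean_mono (hQ : Q ∈ compatible P m) (hint : ∀ X : RV P, Integrable X (Q : Measure Ω)) :
    Monotone fun X : RV P => condMean Q X m := fun X Y h => by
  rw [← AEEqFun.coeFn_le]
  filter_upwards [condExp_mono_of_mem_compatible hQ hint h,
    condMean_coeFn (m := m) (Q := Q) X, condMean_coeFn (m := m) (Q := Q) Y]
    with ω h1 h2 h3
  rwa [h2, h3]

theorem condMean_add (hQ : Q ∈ compatible P m) (hint : ∀ X : RV P, Integrable X (Q : Measure Ω))
    (X Y : RV P) : condMean Q (X + Y) m = condMean Q X m + condMean Q Y m := by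
  refine AEEqFun.ext ?_
  have h1 := (condExp_congr_ae (m := m.1) (hQ.1.ae_le (Lp.coeFn_add X Y))).trans
    (condExp_add (hint X) (hint Y) m.1)
  have h2 := (ae_eq_iff_of_mem_compatible hQ stronglyMeasurable_condExp
    (stronglyMeasurable_condExp.add stronglyMeasurable_condExp)).1 h1
  filter_upwards [h2, condMean_coeFn (m := m) (Q := Q) X, condMean_coeFn (m := m) (Q := Q) Y,
    condMean_coeFn (m := m) (Q := Q) (X + Y), AEEqFun.coeFn_add (condMean Q X m) (condMean Q Y m)]
    with ω h1 h2 h3 h4 h5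
  rw [h4, h1, h5, Pi.add_apply, Pi.add_apply, h2, h3]

theorem condMean_smul (hQ : Q ∈ compatible P m) (c : ℝ) (X : RV P) :
    condMean Q (c • X) m = c • condMean Q X m := by
  refine AEEqFun.ext ?_
  have h1 := (condExp_congr_ae (m := m.1) (hQ.1.ae_le (Lp.coeFn_smul c X))).trans
    (condExp_smul c (X : Ω → ℝ) m.1)
  have h2 := (ae_eq_iff_of_mem_compatible hQ stronglyMeasurable_condExp
    (stronglyMeasurable_condExp.const_smul c)).1 h1
  filter_upwards [h2, condMean_coeFn (m := m) (Q := Q) X,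
    condMean_coeFn (m := m) (Q := Q) (c • X), AEEqFun.coeFn_smul c (condMean Q X m)]
    with ω h1 h2 h4 h5
  rw [h4, h1, h5, Pi.smul_apply, Pi.smul_apply, h2]

theorem condMean_of_isMeasurableFor (hQ : Q ∈ compatible P m)
    (hint : ∀ X : RV P, Integrable X (Q : Measure Ω)) {X : RV P} (hX : IsMeasurableFor X m) :
    condMean Q X m = (X : Ω →ₘ[P] ℝ) := by
  refine AEEqFun.ext ?_
  obtain ⟨g, hg, hXg⟩ := hX
  have hXg' := hQ.1.ae_le hXg
  have h1 := condExp_congr_ae (m := m.1) hXg'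
  rw [condExp_of_stronglyMeasurable m.2 hg ((hint X).congr hXg')] at h1
  have h2 := (ae_eq_iff_of_mem_compatible hQ stronglyMeasurable_condExp hg).1 h1
  filter_upwards [h2, condMean_coeFn (m := m) (Q := Q) X, hXg] with ω h1 h2 h3
  rw [h2, h1, h3]

/-- Continuity from above of conditional means: the conditional means decrease and their integrals
converge, so they converge a.e. -/
theorem le_condMean_of_decreasesTo (hQ : Q ∈ compatible P m)
    (hint : ∀ X : RV P, Integrable X (Q : Measure Ω)) {X : ℕ → RV P} {X' : RV P}
    (h : DecreasesTo X X') {w : Ω →ₘ[P] ℝ} (hw : ∀ k, w ≤ condMean Q (X k) m) :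
    w ≤ condMean Q X' m := by
  have hlim : ∀ᵐ ω ∂P, Filter.Tendsto (fun k => ((Q : Measure Ω)[(X k : Ω → ℝ) | m.1]) ω)
      Filter.atTop (nhds (((Q : Measure Ω)[(X' : Ω → ℝ) | m.1]) ω)) := by
    refine tendsto_of_integral_tendsto_of_antitone
      (fun k => integrable_condExp_of_mem_compatible hQ _)
      (integrable_condExp_of_mem_compatible hQ _) ?_ ?_ ?_
    · simp only [integral_condExp_of_mem_compatible hQ]
      exact integral_tendsto_of_tendsto_of_antitone (fun k => hint (X k)) (hint X')
        (hQ.1.ae_le (ae_antitone h.1)) (hQ.1.ae_le h.tendsto)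
    · have : ∀ᵐ ω ∂P, ∀ k, ((Q : Measure Ω)[(X (k + 1) : Ω → ℝ) | m.1]) ω ≤
          ((Q : Measure Ω)[(X k : Ω → ℝ) | m.1]) ω :=
        ae_all_iff.2 fun k => condExp_mono_of_mem_compatible hQ hint (h.1 k.le_succ)
      exact this.mono fun ω h => antitone_nat_of_succ_le h
    · exact ae_all_iff.2 fun k => condExp_mono_of_mem_compatible hQ hint (h.2.1 ⟨k, rfl⟩)
  have hw' : ∀ᵐ ω ∂P, ∀ k, w ω ≤ ((Q : Measure Ω)[(X k : Ω → ℝ) | m.1]) ω :=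
    ae_all_iff.2 fun k => ((AEEqFun.coeFn_le).2 (hw k)).trans (condMean_coeFn (X k)).le
  rw [← AEEqFun.coeFn_le]
  filter_upwards [hlim, hw', condMean_coeFn (m := m) (Q := Q) X'] with ω h1 h2 h3
  rw [h3]
  exact ge_of_tendsto' h1 h2

end Compatible

/-! ### Conditional coherent utilities -/

/-- `ψ` is a conditional coherent utility on `L¹` given `m`: monotone, superadditive, positively
homogeneous, with `m`-measurable values, the identity on `m`-measurable variables, and continuous
from above along dominated sequences. -/
structure CondUtility (P : Measure Ω) (m : SubSigma Ω) (ψ : RV P → RV P) : Prop where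
  mono : Monotone ψ
  superadd : ∀ X Y, ψ X + ψ Y ≤ ψ (X + Y)
  homog : ∀ (c : ℝ) (X : RV P), 0 ≤ c → ψ (c • X) = c • ψ X
  meas : ∀ X, IsMeasurableFor (ψ X) m
  fix : ∀ X, IsMeasurableFor X m → ψ X = X
  cont : ∀ (X : ℕ → RV P) (X' Y : RV P), DecreasesTo X X' → (∀ k, |X k| ≤ Y) →
    DecreasesTo (fun k => ψ (X k)) (ψ X')

/-- The measures representing `ψ`: those that agree with `P` on `m` and dominate the unconditional
utility `X ↦ E^P[ψ X]`. The domination is required only in mean; locality of `ψ` turns it into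
`ψ X ≤ E^Q[X | m]`. -/
def representing (m : SubSigma Ω) (ψ : RV P → RV P) : Set (ProbabilityMeasure Ω) :=
  {Q | Q ∈ compatible P m ∧ (∀ X : RV P, Integrable X (Q : Measure Ω)) ∧
    ∀ X : RV P, ∫ ω, ψ X ω ∂P ≤ ∫ ω, X ω ∂(Q : Measure Ω)}

/-- The variable `1_A X`. -/
def cut (X : RV P) {A : Set Ω} (hA : MeasurableSet A) : RV P :=
  ((L1.integrable_coeFn X).indicator hA).toL1 _

theorem cut_coeFn (X : RV P) {A : Set Ω} (hA : MeasurableSet A) :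
    (cut X hA : Ω → ℝ) =ᵐ[P] A.indicator X :=
  Integrable.coeFn_toL1 _

theorem isMeasurableFor_ind [IsFiniteMeasure P] {m : SubSigma Ω} {A : Set Ω}
    (hA : MeasurableSet[m.1] A) : IsMeasurableFor (ind P (m.2 A hA)) m :=
  ⟨A.indicator fun _ => 1, stronglyMeasurable_const.indicator hA, ind_coeFn _⟩

theorem IsMeasurableFor.smul {m : SubSigma Ω} {X : RV P} (hX : IsMeasurableFor X m) (c : ℝ) :
    IsMeasurableFor (c • X) m :=
  (AEStronglyMeasurable.const_smul hX c).congr (Lp.coeFn_smul c X).symm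

theorem isMeasurableFor_zero (m : SubSigma Ω) : IsMeasurableFor (0 : RV P) m :=
  ⟨0, stronglyMeasurable_zero, Lp.coeFn_zero ℝ 1 P⟩

namespace CondUtility

variable {m : SubSigma Ω} {ψ : RV P → RV P}

theorem map_zero (hψ : CondUtility P m ψ) : ψ 0 = 0 :=
  hψ.fix 0 (isMeasurableFor_zero m)

/-- One half of translation invariance along `m`-measurable variables. -/
theorem add_le (hψ : CondUtility P m ψ) (X : RV P) {Z : RV P}
    (hZ : IsMeasurableFor Z m) : ψ (X + Z) ≤ ψ X + Z := by
  have h1 := hψ.superadd (X + Z) (-Z)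
  have h2 : IsMeasurableFor (-Z) m := by simpa using hZ.smul (-1)
  rw [hψ.fix _ h2, add_neg_cancel_right] at h1
  have h3 := add_le_add_left h1 Z
  rwa [add_assoc, neg_add_cancel, add_zero] at h3

/-- Locality: if `X ≤ Y` up to a variable `V` that vanishes on `A ∈ m`, then `ψ X ≤ ψ Y` on `A`.
For bounded `V` this is monotonicity and translation by a multiple of `1_{Aᶜ}`; continuity from
above removes the truncation. -/
theorem ae_le_of_le_add [IsFiniteMeasure P] (hψ : CondUtility P m ψ) {A : Set Ω}
    (hA : MeasurableSet[m.1] A) {X Y V : RV P} (hV : ∀ᵐ ω ∂P, ω ∈ A → V ω = 0) (h : X ≤ Y + V) :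
    ∀ᵐ ω ∂P, ω ∈ A → ψ X ω ≤ ψ Y ω := by
  have hAm := m.2 A hA
  have hi : ∀ k : ℕ, Integrable (fun ω => max (|V ω| - k) 0) P := fun k =>
    ((L1.integrable_coeFn V).abs.sub (integrable_const _)).pos_part
  -- `V ≤ k 1_{Aᶜ} + W k`, where `W k` is the part of `|V|` above the level `k`.
  let W : ℕ → RV P := fun k => (hi k).toL1 _
  have hWc : ∀ k, (W k : Ω → ℝ) =ᵐ[P] fun ω => max (|V ω| - k) 0 := fun k =>
    Integrable.coeFn_toL1 _
  have hW : ∀ᵐ ω ∂P, ∀ k, W k ω = max (|V ω| - k) 0 := ae_all_iff.2 hWc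
  have hadd : ∀ᵐ ω ∂P, ∀ k, (Y + W k) ω = Y ω + W k ω := ae_all_iff.2 fun k => Lp.coeFn_add Y (W k)
  have hdec : DecreasesTo (fun k => Y + W k) Y := by
    refine decreasesTo_of_tendsto (fun j k hjk => ?_) ?_
    · rw [← Lp.coeFn_le]
      filter_upwards [hadd, hW] with ω h1 h2
      have : (j : ℝ) ≤ k := Nat.cast_le.2 hjk
      rw [h1, h1, h2, h2]
      gcongr
    · filter_upwards [hadd, hW] with ω h1 h2
      obtain ⟨N, hN⟩ := exists_nat_ge |V ω|
      refine tendsto_const_nhds.congr' ((Filter.eventually_ge_atTop N).mono fun k hk => ?_)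
      have : (N : ℝ) ≤ k := Nat.cast_le.2 hk
      change Y ω = (Y + W k) ω
      rw [h1, h2, max_eq_right (by linarith), add_zero]
  have hbd : ∀ k, |Y + W k| ≤ |Y| + |V| := fun k => by
    rw [← Lp.coeFn_le]
    filter_upwards [hadd, hW, Lp.coeFn_abs (Y + W k), Lp.coeFn_add |Y| |V|, Lp.coeFn_abs Y,
      Lp.coeFn_abs V] with ω h1 h2 h3 h4 h5 h6
    rw [h3, h4, Pi.add_apply, h5, h6, h1, h2]
    refine (abs_add_le _ _).trans ?_
    have := abs_nonneg (V ω)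
    have hk : (0 : ℝ) ≤ k := k.cast_nonneg
    rw [abs_of_nonneg (le_max_right (|V ω| - k) 0)]
    gcongr
    exact max_le (by linarith) this
  have hlim := (hψ.cont _ _ _ hdec hbd).tendsto
  have hstep : ∀ k : ℕ, ψ X ≤ ψ (Y + W k) + (k : ℝ) • ind P hAm.compl := fun k => by
    refine (hψ.mono ?_).trans (hψ.add_le (Y + W k)
      ((isMeasurableFor_ind (P := P) (MeasurableSet.compl hA)).smul k))
    rw [← Lp.coeFn_le] at h ⊢
    filter_upwards [h, hadd, hW, hV, Lp.coeFn_add (Y + W k) ((k : ℝ) • ind P hAm.compl),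
      Lp.coeFn_smul (k : ℝ) (ind P hAm.compl), ind_coeFn (P := P) hAm.compl, Lp.coeFn_add Y V]
      with ω h1 h2 h3 h4 h5 h6 h7 h8
    rw [h5, Pi.add_apply, h6, Pi.smul_apply, h7, h2, h3]
    rw [h8, Pi.add_apply] at h1
    by_cases hω : ω ∈ A
    · have := le_max_right (|V ω| - k) 0
      simp only [Set.mem_compl_iff, hω, not_true_eq_false, not_false_eq_true,
        Set.indicator_of_notMem, smul_zero]
      rw [h4 hω] at h1
      linarith
    · have := le_max_left (|V ω| - k) 0
      have := le_abs_self (V ω)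
      simp only [Set.mem_compl_iff, hω, not_false_eq_true, Set.indicator_of_mem, smul_eq_mul]
      linarith
  have hstep' : ∀ᵐ ω ∂P, ∀ k : ℕ, ω ∈ A → ψ X ω ≤ ψ (Y + W k) ω := by
    refine ae_all_iff.2 fun k => ?_
    have h1 := (Lp.coeFn_le _ _).2 (hstep k)
    filter_upwards [h1, Lp.coeFn_add (ψ (Y + W k)) ((k : ℝ) • ind P hAm.compl),
      Lp.coeFn_smul (k : ℝ) (ind P hAm.compl), ind_coeFn (P := P) hAm.compl] with ω h1 h2 h3 h4 hω
    rw [h2, Pi.add_apply, h3, Pi.smul_apply, h4] at h1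
    simpa [hω] using h1
  filter_upwards [hlim, hstep'] with ω h1 h2 hω
  exact ge_of_tendsto' h1 fun k => h2 k hω

/-- The integrated form of `ψ X ≤ E^Q[X | m]`, from `1_A ψ X ≤ ψ (1_A X)`. -/
theorem setIntegral_le [IsFiniteMeasure P] (hψ : CondUtility P m ψ) {Q : ProbabilityMeasure Ω}
    (hQ : Q ∈ representing m ψ) {A : Set Ω} (hA : MeasurableSet[m.1] A) (X : RV P) :
    ∫ ω in A, ψ X ω ∂P ≤ ∫ ω in A, X ω ∂(Q : Measure Ω) := by
  have hAm := m.2 A hA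
  have hcut := cut_coeFn X hAm
  have h1 : ∀ᵐ ω ∂P, ω ∈ A → ψ X ω ≤ ψ (cut X hAm) ω := by
    refine hψ.ae_le_of_le_add hA (V := X - cut X hAm) ?_ (by rw [add_sub_cancel])
    filter_upwards [hcut, Lp.coeFn_sub X (cut X hAm)] with ω h1 h2 hω
    rw [h2, Pi.sub_apply, h1, Set.indicator_of_mem hω, sub_self]
  have h2 : ∀ᵐ ω ∂P, ω ∈ Aᶜ → (ψ 0) ω ≤ ψ (cut X hAm) ω := by
    refine hψ.ae_le_of_le_add (MeasurableSet.compl hA) (V := - cut X hAm) ?_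
      (by rw [add_neg_cancel])
    filter_upwards [hcut, Lp.coeFn_neg (cut X hAm)] with ω h1 h2 hω
    rw [h2, Pi.neg_apply, h1, Set.indicator_of_notMem hω, neg_zero]
  rw [hψ.map_zero] at h2
  calc ∫ ω in A, ψ X ω ∂P = ∫ ω, A.indicator (ψ X) ω ∂P := (integral_indicator hAm).symm
    _ ≤ ∫ ω, ψ (cut X hAm) ω ∂P := by
      refine integral_mono_ae ((L1.integrable_coeFn _).indicator hAm) (L1.integrable_coeFn _) ?_
      filter_upwards [h1, h2, Lp.coeFn_zero ℝ 1 P] with ω h1 h2 h3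
      by_cases hω : ω ∈ A
      · simpa [hω] using h1 hω
      · have := h2 hω
        rw [h3] at this
        simpa [hω] using this
    _ ≤ ∫ ω, cut X hAm ω ∂(Q : Measure Ω) := hQ.2.2 _
    _ = ∫ ω in A, X ω ∂(Q : Measure Ω) := by
      rw [integral_congr_ae (hQ.1.1.ae_le hcut), integral_indicator hAm]

theorem ae_le_condExp [IsFiniteMeasure P] (hψ : CondUtility P m ψ) {Q : ProbabilityMeasure Ω}
    (hQ : Q ∈ representing m ψ) (X : RV P) :
    ψ X ≤ᵐ[P] (Q : Measure Ω)[(X : Ω → ℝ) | m.1] := by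
  obtain ⟨g, hg, hXg⟩ := hψ.meas X
  refine hXg.le.trans ?_
  refine ae_le_of_forall_setIntegral_le_trim hg stronglyMeasurable_condExp
    ((L1.integrable_coeFn _).congr hXg) (integrable_condExp_of_mem_compatible hQ.1 _) fun A hA => ?_
  rw [← setIntegral_eq_of_mem_compatible hQ.1 stronglyMeasurable_condExp hA,
    setIntegral_condExp m.2 (hQ.2.1 X) hA, ← integral_congr_ae (ae_restrict_of_ae hXg)]
  exact hψ.setIntegral_le hQ hA X

/-- Hahn-Banach: the superlinear functional `E^P ∘ ψ` has a linear majorant touching it at `Y`. -/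
theorem exists_linear [IsFiniteMeasure P] (hψ : CondUtility P m ψ) (Y : RV P) :
    ∃ ℓ : RV P →ₗ[ℝ] ℝ, ℓ Y = ∫ ω, ψ Y ω ∂P ∧ ∀ X, ∫ ω, ψ X ω ∂P ≤ ℓ X := by
  let u : RV P → ℝ := fun X => ∫ ω, ψ X ω ∂P
  have u_add : ∀ X Z, u X + u Z ≤ u (X + Z) := fun X Z => by
    rw [← integral_add (L1.integrable_coeFn _) (L1.integrable_coeFn _)]
    refine (integral_congr_ae (Lp.coeFn_add (ψ X) (ψ Z)).symm).trans_le ?_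
    exact integral_mono_ae (L1.integrable_coeFn _) (L1.integrable_coeFn _)
      ((Lp.coeFn_le _ _).2 (hψ.superadd X Z))
  have u_smul : ∀ c : ℝ, 0 ≤ c → ∀ X, u (c • X) = c * u X := fun c hc X => by
    simp only [u]
    rw [hψ.homog c X hc, ← integral_const_mul]
    exact integral_congr_ae (Lp.coeFn_smul c (ψ X))
  have u_zero : u 0 = 0 := by simpa using u_smul 0 le_rfl 0
  let f : RV P →ₗ.[ℝ] ℝ := LinearPMap.mkSpanSingleton' Y (u Y) fun c hc => by
    rcases smul_eq_zero.1 hc with h | h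
    · simp [h]
    · simp [h, u_zero]
  -- The sublinear functional of the Hahn-Banach theorem is the conjugate `X ↦ -u (-X)`.
  obtain ⟨ℓ, h1, h2⟩ := exists_extension_of_le_sublinear f (fun X => -u (-X))
    (fun c hc X => by rw [← smul_neg, u_smul c hc.le, mul_neg])
    (fun X Z => by
      have := u_add (-X) (-Z)
      rw [← neg_add] at this
      linarith)
    (by
      rintro ⟨X, hX⟩
      obtain ⟨c, rfl⟩ := Submodule.mem_span_singleton.1 hX
      have hf : f ⟨c • Y, hX⟩ = c * u Y := LinearPMap.mkSpanSingleton'_apply Y (u Y) _ c hX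
      rw [hf]
      rcases le_total 0 c with hc | hc
      · have h1 := u_smul c hc Y
        have h2 := u_add (c • Y) (-(c • Y))
        rw [add_neg_cancel, u_zero] at h2
        simp only
        linarith
      · have := u_smul (-c) (by linarith) Y
        rw [neg_smul] at this
        simp only
        linarith)
  refine ⟨ℓ, ?_, fun X => ?_⟩
  · have hY := Submodule.mem_span_singleton_self (R := ℝ) Y
    exact (h1 ⟨Y, hY⟩).trans (LinearPMap.mkSpanSingleton'_apply_self Y (u Y) _ hY)
  · have := h2 (-X)
    rw [_root_.map_neg, neg_neg] at this
    exact neg_le_neg_iff.1 this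

/-- For every `Y` the unconditional utility `E^P[ψ Y]` is attained by a representing measure. -/
theorem exists_representing [IsProbabilityMeasure P] (hψ : CondUtility P m ψ) (Y : RV P) :
    ∃ Q ∈ representing m ψ, ∫ ω, Y ω ∂(Q : Measure Ω) = ∫ ω, ψ Y ω ∂P := by
  obtain ⟨ℓ, hY, hℓ⟩ := hψ.exists_linear Y
  have hpos : ∀ X, 0 ≤ X → 0 ≤ ℓ X := fun X hX => by
    refine le_trans (integral_nonneg_of_ae ?_) (hℓ X)
    rw [Lp.coeFn_nonneg, ← hψ.map_zero]
    exact hψ.mono hX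
  obtain ⟨Q, C, hle, hint, hrep⟩ := exists_measure_of_positive ℓ hpos
  have hac : Q ≪ P := (Measure.absolutelyContinuous_of_le hle).trans
    (Measure.smul_absolutelyContinuous)
  have : IsFiniteMeasure Q := ⟨(hle Set.univ).trans_lt (by simp)⟩
  have hfix : ∀ Z, IsMeasurableFor Z m → ℓ Z = ∫ ω, Z ω ∂P := fun Z hZ => by
    have h1 := hℓ Z
    have h2 := hℓ (-Z)
    rw [hψ.fix Z hZ] at h1
    rw [hψ.fix (-Z) (by simpa using hZ.smul (-1)), _root_.map_neg,
      integral_congr_ae (Lp.coeFn_neg Z)] at h2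
    simp only [Pi.neg_apply, integral_neg] at h2
    linarith
  have hagree : ∀ A, MeasurableSet[m.1] A → Q A = P A := fun A hA => by
    have h1 := hfix _ (isMeasurableFor_ind (P := P) hA)
    rw [hrep, integral_congr_ae (hac.ae_le (ind_coeFn _)), integral_congr_ae (ind_coeFn _),
      integral_indicator (m.2 A hA), integral_indicator (m.2 A hA)] at h1
    simpa [measureReal_def, ENNReal.toReal_eq_toReal_iff'] using h1
  have hprob : IsProbabilityMeasure Q := ⟨by rw [hagree _ MeasurableSet.univ, measure_univ]⟩
  refine ⟨⟨Q, hprob⟩, ⟨⟨hac, hagree⟩, hint, fun X => ?_⟩, ?_⟩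
  · exact (hℓ X).trans_eq (hrep X)
  · exact (hrep Y).symm.trans hY

theorem isGLB_condMean [IsProbabilityMeasure P] (hψ : CondUtility P m ψ) (X : RV P) :
    IsGLB ((fun Q => condMean Q X m) '' representing m ψ) (ψ X : Ω →ₘ[P] ℝ) := by
  constructor
  · rintro _ ⟨Q, hQ, rfl⟩
    rw [← AEEqFun.coeFn_le]
    exact (hψ.ae_le_condExp hQ X).trans (condMean_coeFn X).symm.le
  · intro w hw
    obtain ⟨Q, hQ, hX⟩ := hψ.exists_representing X
    have h1 := (integral_eq_iff_of_ae_le (L1.integrable_coeFn _)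
      (integrable_condExp_of_mem_compatible hQ.1 _) (hψ.ae_le_condExp hQ X)).1
      (by rw [integral_condExp_of_mem_compatible hQ.1, hX])
    refine (hw ⟨Q, hQ, rfl⟩).trans ?_
    rw [← AEEqFun.coeFn_le]
    exact (condMean_coeFn X).le.trans h1.symm.le

end CondUtility

/-! ### Essential infima of conditional means are conditional utilities -/

theorem aeeqFun_add_le_add {a b c d : Ω →ₘ[P] ℝ} (h1 : a ≤ b) (h2 : c ≤ d) : a + c ≤ b + d := by
  rw [← AEEqFun.coeFn_le] at *
  filter_upwards [h1, h2, AEEqFun.coeFn_add a c, AEEqFun.coeFn_add b d] with ω h1 h2 h3 h4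
  rw [h3, h4]
  exact add_le_add h1 h2

theorem aeeqFun_smul_le_smul {a b : Ω →ₘ[P] ℝ} {c : ℝ} (hc : 0 ≤ c) (h : a ≤ b) :
    c • a ≤ c • b := by
  rw [← AEEqFun.coeFn_le] at *
  filter_upwards [h, AEEqFun.coeFn_smul c a, AEEqFun.coeFn_smul c b] with ω h1 h3 h4
  rw [h3, h4]
  exact mul_le_mul_of_nonneg_left h1 hc

/-- The a.s. order has no greatest element, so a set with an infimum is nonempty. -/
theorem nonempty_of_isGLB [IsProbabilityMeasure P] {s : Set (Ω →ₘ[P] ℝ)} {h : RV P}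
    (hs : IsGLB s (h : Ω →ₘ[P] ℝ)) : s.Nonempty := by
  by_contra hne
  rw [Set.not_nonempty_iff_eq_empty] at hne
  subst hne
  have h1 : h + ind P MeasurableSet.univ ≤ h :=
    isGLB_empty_iff.1 hs ((h + ind P MeasurableSet.univ : RV P) : Ω →ₘ[P] ℝ)
  have h2 := (Lp.coeFn_le _ _).2 (add_le_iff_nonpos_right h |>.1 h1)
  have h3 : ∀ᵐ _ : Ω ∂P, False := by
    filter_upwards [h2, ind_coeFn (P := P) MeasurableSet.univ, Lp.coeFn_zero ℝ 1 P] with ω h2 h3 h4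
    rw [h3, h4] at h2
    simp at h2
    linarith
  exact h3.exists.choose_spec

theorem condUtility_of_isGLB [IsProbabilityMeasure P] {m : SubSigma Ω} {ψ : RV P → RV P}
    {𝒬 : Set (ProbabilityMeasure Ω)} (h𝒬 : 𝒬 ⊆ compatible P m)
    (hint : ∀ Q ∈ 𝒬, ∀ X : RV P, Integrable X (Q : Measure Ω))
    (hglb : ∀ X, IsGLB ((fun Q => condMean Q X m) '' 𝒬) (ψ X : Ω →ₘ[P] ℝ)) :
    CondUtility P m ψ := by
  have hne : 𝒬.Nonempty := (nonempty_of_isGLB (hglb 0)).of_image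
  have hle : ∀ X, ∀ Q ∈ 𝒬, (ψ X : Ω →ₘ[P] ℝ) ≤ condMean Q X m := fun X Q hQ =>
    (hglb X).1 ⟨Q, hQ, rfl⟩
  have hge : ∀ (X : RV P) (Z : RV P), (∀ Q ∈ 𝒬, (Z : Ω →ₘ[P] ℝ) ≤ condMean Q X m) → Z ≤ ψ X :=
    fun X Z h => (hglb X).2 (by rintro _ ⟨Q, hQ, rfl⟩; exact h Q hQ)
  have hmono : Monotone ψ := fun X Y h => hge _ _ fun Q hQ =>
    (hle X Q hQ).trans (condMean_mono (h𝒬 hQ) (hint Q hQ) h)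
  have hfix : ∀ X, IsMeasurableFor X m → ψ X = X := fun X hX => by
    obtain ⟨Q, hQ⟩ := hne
    refine le_antisymm ?_ (hge _ _ fun R hR => ?_)
    · exact (hle X Q hQ).trans_eq (condMean_of_isMeasurableFor (h𝒬 hQ) (hint Q hQ) hX)
    · exact (condMean_of_isMeasurableFor (h𝒬 hR) (hint R hR) hX).ge
  have hsmul : ∀ (c : ℝ) (X : RV P), 0 ≤ c → c • ψ X ≤ ψ (c • X) := fun c X hc =>
    hge _ _ fun Q hQ => by
      rw [condMean_smul (h𝒬 hQ)]
      exact aeeqFun_smul_le_smul hc (hle X Q hQ)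
  refine ⟨hmono, fun X Y => hge _ _ fun Q hQ => ?_, fun c X hc => ?_, fun X => ?_, hfix,
    fun X X' Y hX hY => ⟨fun j k hjk => hmono (hX.1 hjk), ?_, fun W hW => ?_⟩⟩
  · rw [condMean_add (h𝒬 hQ) (hint Q hQ)]
    exact aeeqFun_add_le_add (hle X Q hQ) (hle Y Q hQ)
  · rcases hc.eq_or_lt with rfl | hc'
    · rw [zero_smul, zero_smul, hfix 0 (isMeasurableFor_zero m)]
    · refine le_antisymm ?_ (hsmul c X hc)
      have h1 := rv_smul_le_smul hc (hsmul c⁻¹ (c • X) (inv_nonneg.2 hc))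
      rwa [smul_smul, smul_smul, mul_inv_cancel₀ hc'.ne', inv_mul_cancel₀ hc'.ne', one_smul,
        one_smul] at h1
  -- `E^P[ψ X | m]` is a lower bound as well, hence at most `ψ X`; the integrals agree.
  · have hEi : Integrable (P[(ψ X : Ω → ℝ) | m.1]) P := integrable_condExp
    have hE : hEi.toL1 _ ≤ ψ X := hge _ _ fun Q hQ => by
      have h1 := (AEEqFun.coeFn_le.2 (hle X Q hQ)).trans (condMean_coeFn X).le
      have h2 := condExp_mono (m := m.1) (L1.integrable_coeFn (ψ X))
        (integrable_condExp_of_mem_compatible (h𝒬 hQ) X) h1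
      rw [condExp_of_stronglyMeasurable m.2 stronglyMeasurable_condExp
        (integrable_condExp_of_mem_compatible (h𝒬 hQ) X)] at h2
      rw [← AEEqFun.coeFn_le]
      exact hEi.coeFn_toL1.le.trans (h2.trans (condMean_coeFn X).symm.le)
    have h3 := hEi.coeFn_toL1.symm.le.trans ((Lp.coeFn_le _ _).2 hE)
    have h4 := (integral_eq_iff_of_ae_le hEi (L1.integrable_coeFn (ψ X)) h3).1
      (integral_condExp m.2)
    exact ⟨_, stronglyMeasurable_condExp, h4.symm⟩
  · rintro _ ⟨k, rfl⟩
    exact hmono (hX.2.1 ⟨k, rfl⟩)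
  · refine hge _ _ fun Q hQ => le_condMean_of_decreasesTo (h𝒬 hQ) (hint Q hQ) hX fun k => ?_
    have h1 : W ≤ ψ (X k) := hW ⟨k, rfl⟩
    exact le_trans (b := (ψ (X k) : Ω →ₘ[P] ℝ)) h1 (hle (X k) Q hQ)

/-! ### Allocations among two or three agents -/

section Allocation

variable {n : ℕ}

theorem total_add (X Y : Fin n → RV P) : total (X + Y) = total X + total Y :=
  Finset.sum_add_distrib

theorem total_sub (X Y : Fin n → RV P) : total (X - Y) = total X - total Y :=
  Finset.sum_sub_distrib _ _

theorem total_single (i : Fin n) (Z : RV P) : total (Pi.single i Z) = Z :=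
  Fintype.sum_pi_single' i Z

theorem total_transfer (X : Fin n → RV P) (i j : Fin n) (Z : RV P) :
    total (X + Pi.single j Z - Pi.single i Z) = total X := by
  rw [total_sub, total_add, total_single, total_single, add_sub_cancel_right]

theorem transfer_fst (X : Fin n → RV P) {i j : Fin n} (h : i ≠ j) (Z : RV P) :
    (X + Pi.single j Z - Pi.single i Z : Fin n → RV P) i = X i - Z := by
  simp [h]

theorem transfer_snd (X : Fin n → RV P) {i j : Fin n} (h : i ≠ j) (Z : RV P) :
    (X + Pi.single j Z - Pi.single i Z : Fin n → RV P) j = X j + Z := by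
  simp [h.symm]

/-- Agent `i` owns `Z`, agent `j` the rest of the aggregate `S`, all others nothing. -/
def twoAgent (i j : Fin n) (S Z : RV P) : Fin n → RV P :=
  Pi.single i Z + Pi.single j (S - Z)

theorem total_twoAgent (i j : Fin n) (S Z : RV P) : total (twoAgent i j S Z) = S := by
  rw [twoAgent, total_add, total_single, total_single, add_sub_cancel]

theorem twoAgent_apply {i j : Fin n} (h : i ≠ j) (S Z : RV P) : twoAgent i j S Z i = Z := by
  simp [twoAgent, h]

/-- Agent `i` owns `Z`, agent `j` owns `W`, agent `k` the rest of the aggregate `S`, all others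
nothing. -/
def threeAgent (i j k : Fin n) (S Z W : RV P) : Fin n → RV P :=
  Pi.single i Z + Pi.single j W + Pi.single k (S - Z - W)

theorem total_threeAgent (i j k : Fin n) (S Z W : RV P) : total (threeAgent i j k S Z W) = S := by
  simp only [threeAgent, total_add, total_single]
  abel

theorem threeAgent_fst {i j k : Fin n} (hij : i ≠ j) (hik : i ≠ k) (S Z W : RV P) :
    threeAgent i j k S Z W i = Z := by
  simp [threeAgent, hij, hik]

theorem threeAgent_snd {i j k : Fin n} (hij : i ≠ j) (hjk : j ≠ k) (S Z W : RV P) :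
    threeAgent i j k S Z W j = W := by
  simp [threeAgent, hij.symm, hjk]

/-- All agents other than `i` may be merged into a single agent `j` without affecting `i`. -/
theorem OperationalAnonymity.eq_twoAgent {H : Mapping P n} (h : OperationalAnonymity H)
    (X : Fin n → RV P) (G : SubSigma Ω) {i j : Fin n} (hij : i ≠ j) :
    H X G i = H (twoAgent i j (total X) (X i)) G i := by
  -- The allocation in which the agents of `s` have handed their endowments over to `j`.
  let M : Finset (Fin n) → Fin n → RV P := fun s =>
    X - ∑ k ∈ s, Pi.single k (X k) + ∑ k ∈ s, Pi.single j (X k)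
  have key : ∀ s : Finset (Fin n), i ∉ s → j ∉ s → H (M s) G i = H X G i := by
    intro s
    induction s using Finset.induction_on with
    | empty => intro _ _; simp [M]
    | insert k s hk ih =>
      intro hi hj
      rw [Finset.mem_insert, not_or] at hi hj
      rw [← ih hi.2 hj.2]
      have hMk : M s k = X k := by
        simp [M, hk, Finset.sum_apply, Pi.single_apply, Ne.symm hj.1]
      rw [← h G (M s) j k i hij hi.1, hMk]
      congr 1
      simp only [M, Finset.sum_insert hk]
      abel
  rw [← key ((Finset.univ.erase i).erase j) (by simp) (by simp)]
  congr 1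
  have hj : j ∈ Finset.univ.erase i := by simp [hij.symm]
  have h1 : ∑ k, Pi.single k (X k) = X := Finset.univ_sum_single X
  have h2 : total X = ∑ k, X k := rfl
  rw [← Finset.add_sum_erase _ _ (Finset.mem_univ i), ← Finset.add_sum_erase _ _ hj] at h1 h2
  have h3 : ∑ k ∈ (Finset.univ.erase i).erase j, (Pi.single j (X k) : Fin n → RV P) =
      Pi.single j (∑ k ∈ (Finset.univ.erase i).erase j, X k) :=
    (map_sum (AddMonoidHom.single (fun _ : Fin n => RV P) j) _ _).symm
  simp only [M]
  rw [h3, twoAgent, h2, add_sub_cancel_left, Pi.single_add]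
  nth_rw 1 [← h1]
  abel

/-! ### The axioms in terms of conditional utilities -/

/-- `H` allocates to each agent a conditional coherent utility, given `G^S`, of the agent's own
endowment; the utility depends on the other agents only through the aggregate `S`. -/
def IsUtilityBased (H : Mapping P n) : Prop :=
  ∃ φ : RV P → SubSigma Ω → RV P → RV P, (∀ X G i, H X G i = φ (total X) G (X i)) ∧
    ∀ S G, CondUtility P (augment G S) (φ S G)

theorem isUtilityBased_of_axioms (hn : 3 ≤ n) {H : Mapping P n} (hA : AllocationAxioms H)
    (hP : AllocationProperties H) : IsUtilityBased H := by
  let a : Fin n := ⟨0, by omega⟩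
  let b : Fin n := ⟨1, by omega⟩
  let c : Fin n := ⟨2, by omega⟩
  have hab : a ≠ b := by simp [a, b]
  have hac : a ≠ c := by simp [a, c]
  have hbc : b ≠ c := by simp [b, c]
  have hform : ∀ X G i, H X G i = H (twoAgent a b (total X) (X i)) G a := fun X G i => by
    have h1 := hA.agentAnonymity (Equiv.swap i a) G X a
    rw [Equiv.swap_apply_right] at h1
    rw [← h1, hA.operationalAnonymity.eq_twoAgent _ G hab, Equiv.swap_apply_right]
    have h2 : total (fun k => X (Equiv.swap i a k)) = total X := Equiv.sum_comp (Equiv.swap i a) X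
    rw [h2]
  refine ⟨fun S G Z => H (twoAgent a b S Z) G a, hform, fun S G => ?_⟩
  set ψ : RV P → RV P := fun Z => H (twoAgent a b S Z) G a
  have hH : ∀ X i, total X = S → H X G i = ψ (X i) := fun X i hX => by rw [hform, hX]
  have hzero : ψ 0 = 0 := hP.zeroPreserving G _ a (twoAgent_apply hab S 0)
  -- SI covers factors in `[0, 1]`; larger factors follow by inverting.
  have hscale : ∀ (t : ℝ) (Z : RV P), 0 ≤ t → t ≤ 1 → ψ (t • Z) = t • ψ Z := fun t Z h0 h1 => by
    have h2 := hA.scaleInvariance G a b t (threeAgent a b c S Z 0) h0 h1 (threeAgent_snd hab hbc ..)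
    rw [threeAgent_fst hab hac, hH _ a (total_threeAgent ..), threeAgent_fst hab hac, hH _ b] at h2
    · rwa [transfer_snd _ hab, threeAgent_snd hab hbc, zero_add] at h2
    · rw [total_transfer, total_threeAgent]
  refine ⟨fun W Z hWZ => ?_, fun Z W => ?_, fun t Z ht => ?_, fun Z => ?_, fun Z hZ => ?_,
    fun X X' Y hX hY => ?_⟩
  · have h := hA.internalFairness G (threeAgent a b c S Z W) a b
      (by rwa [threeAgent_fst hab hac, threeAgent_snd hab hbc])
    rwa [hH _ a (total_threeAgent ..), hH _ b (total_threeAgent ..), threeAgent_fst hab hac,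
      threeAgent_snd hab hbc] at h
  · have h := hA.frictionalParticipation G Z a b (threeAgent a b c S (Z + W) 0)
      (threeAgent_snd hab hbc ..)
    have ht : total (threeAgent a b c S (Z + W) 0 + Pi.single b Z - Pi.single a Z) = S := by
      rw [total_transfer, total_threeAgent]
    simp only [localCost] at h
    rw [hH _ a ht, hH _ b ht, transfer_fst _ hab, transfer_snd _ hab,
      hH _ a (total_threeAgent ..), hH _ b (total_threeAgent ..),
      threeAgent_fst hab hac, threeAgent_snd hab hbc, hzero, add_sub_cancel_left, zero_add] at h
    have h' := add_le_add_left h (ψ Z + ψ W + ψ (Z + W) - (Z + W))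
    convert h' using 1 <;> abel
  · rcases le_total t 1 with h1 | h1
    · exact hscale t Z ht h1
    · have ht0 : t ≠ 0 := by linarith
      have h2 := hscale t⁻¹ (t • Z) (inv_nonneg.2 ht) (inv_le_one_of_one_le₀ h1)
      rw [smul_smul, inv_mul_cancel₀ ht0, one_smul] at h2
      change ψ (t • Z) = t • ψ Z
      rw [h2, smul_smul, mul_inv_cancel₀ ht0, one_smul]
  · have h := hP.informationAnonymity G (twoAgent a b S Z) a
    rwa [total_twoAgent] at h
  · have h := hP.informationBacktracking G a (twoAgent a b S Z)
    rw [total_twoAgent, twoAgent_apply hab] at h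
    exact h hZ
  · exact hP.continuityFromAbove X X' Y hX hY S G a b hab

theorem isMeasurableFor_augment (G : SubSigma Ω) (S : RV P) : IsMeasurableFor S (augment G S) := by
  have h : Measurable[(augment G S).1] (S : Ω → ℝ) := by
    have h1 : Measurable[MeasurableSpace.comap (S : Ω → ℝ) (borel ℝ)] (S : Ω → ℝ) := by
      rw [← BorelSpace.measurable_eq (α := ℝ)]
      exact comap_measurable _
    exact h1.mono le_sup_right le_rfl
  exact ⟨_, h.stronglyMeasurable, .rfl⟩

theorem IsUtilityBased.isAllocationMechanism {H : Mapping P n} (h : IsUtilityBased H) :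
    IsAllocationMechanism H := by
  obtain ⟨φ, hφ, hU⟩ := h
  intro X G
  have hsum : ∀ s : Finset (Fin n),
      ∑ i ∈ s, φ (total X) G (X i) ≤ φ (total X) G (∑ i ∈ s, X i) := by
    intro s
    induction s using Finset.induction_on with
    | empty => simp [(hU (total X) G).map_zero]
    | insert k s hk ih =>
      rw [Finset.sum_insert hk, Finset.sum_insert hk]
      exact (add_le_add_right ih _).trans ((hU (total X) G).superadd _ _)
  simp only [hφ]
  exact (hsum Finset.univ).trans_eq ((hU _ G).fix _ (isMeasurableFor_augment G _))

theorem IsUtilityBased.allocationAxioms {H : Mapping P n} (h : IsUtilityBased H) :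
    AllocationAxioms H := by
  obtain ⟨φ, hφ, hU⟩ := h
  refine ⟨fun G X i j h => ?_, fun π G X i => ?_, fun G X i j k hi hj => ?_,
    fun G Z i j X hX => ?_, fun G i j t X h0 h1 hX => ?_⟩
  · rw [hφ, hφ]
    exact (hU _ G).mono h
  · have h2 : total (fun k => X (π k)) = total X := Equiv.sum_comp π X
    rw [hφ, hφ, h2]
  · rw [hφ, hφ, total_add, total_sub, total_single, total_single, sub_add_cancel]
    simp [hi, hj]
  -- For `i = j` the transfer is void.
  · simp only [localCost, hφ, total_transfer]
    rcases eq_or_ne i j with rfl | hij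
    · simp
    · have h1 := (hU (total X) G).superadd (X i - Z) Z
      rw [transfer_fst X hij, transfer_snd X hij, hX, (hU _ G).map_zero, zero_add]
      rw [sub_add_cancel] at h1
      have h2 := sub_le_sub_left h1 (X i)
      convert h2 using 1 <;> abel
  · simp only [hφ, total_transfer]
    rcases eq_or_ne i j with rfl | hij
    · simp [hX, (hU _ G).map_zero]
    · rw [transfer_snd X hij, hX, zero_add, (hU _ G).homog t _ h0]

theorem IsUtilityBased.allocationProperties {H : Mapping P n} (h : IsUtilityBased H) :
    AllocationProperties H := by
  obtain ⟨φ, hφ, hU⟩ := h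
  refine ⟨fun G X i h => ?_, fun G X i => ?_, fun G i X h => ?_,
    fun X X' Y hX hY S G i j hij => ?_⟩
  · rw [hφ, h, (hU _ G).map_zero]
  · rw [hφ]
    exact (hU _ G).meas _
  · rw [hφ]
    exact (hU _ G).fix _ h
  · have h : ∀ Z, H (Pi.single i Z + Pi.single j (S - Z)) G i = φ S G Z := fun Z => by
      have := hφ (twoAgent i j S Z) G i
      rwa [total_twoAgent, twoAgent_apply hij] at this
    simp only [h]
    exact (hU S G).cont X X' Y hX hY

/-! ### Robust conditional means in terms of conditional utilities -/

theorem IsUtilityBased.exists_isRobustConditionalMean [IsProbabilityMeasure P] {H : Mapping P n}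
    (h : IsUtilityBased H) : ∃ 𝒬 : RV P → SubSigma Ω → Set (ProbabilityMeasure Ω),
      IsRobustConditionalMean H (fun _ => 𝒬) ∧ ∀ S G, 𝒬 S G ⊆ compatible P (augment G S) := by
  obtain ⟨φ, hφ, hU⟩ := h
  refine ⟨fun S G => representing (augment G S) (φ S G), fun X G i => ⟨fun Q hQ => hQ.2.1 _, ?_⟩,
    fun S G Q hQ => hQ.1⟩
  rw [hφ]
  exact (hU _ G).isGLB_condMean (X i)

theorem IsRobustConditionalMean.isUtilityBased [IsProbabilityMeasure P] (hn : 2 ≤ n)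
    {H : Mapping P n} {𝒬 : RV P → SubSigma Ω → Set (ProbabilityMeasure Ω)}
    (h : IsRobustConditionalMean H (fun _ => 𝒬))
    (h𝒬 : ∀ S G, 𝒬 S G ⊆ compatible P (augment G S)) : IsUtilityBased H := by
  let a : Fin n := ⟨0, by omega⟩
  let b : Fin n := ⟨1, by omega⟩
  have hab : a ≠ b := by simp [a, b]
  have htwo : ∀ (S : RV P) (G : SubSigma Ω) (Z : RV P),
      (∀ Q ∈ 𝒬 S G, Integrable (Z : Ω → ℝ) (Q : Measure Ω)) ∧
      IsGLB ((fun Q => condMean Q Z (augment G S)) '' 𝒬 S G)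
        (H (twoAgent a b S Z) G a : Ω →ₘ[P] ℝ) := fun S G Z => by
    have := h (twoAgent a b S Z) G a
    rwa [total_twoAgent, twoAgent_apply hab] at this
  refine ⟨fun S G Z => H (twoAgent a b S Z) G a, fun X G i => ?_, fun S G => ?_⟩
  · exact Subtype.ext ((h X G i).2.unique (htwo (total X) G (X i)).2)
  · exact condUtility_of_isGLB (h𝒬 S G) (fun Q hQ Z => (htwo S G Z).1 Q hQ)
      fun Z => (htwo S G Z).2

end Allocation

end Alloc

end

theorem theorem2 {Ω : Type*} [MeasurableSpace Ω] (P : Measure Ω) [IsProbabilityMeasure P]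
    (n : ℕ) (hn : 3 ≤ n) (H : Alloc.Mapping P n) :
    (Alloc.IsAllocationMechanism H ∧ Alloc.AllocationAxioms H ∧ Alloc.AllocationProperties H) ↔
      ∃ 𝒬 : Fin n → Alloc.RV P → Alloc.SubSigma Ω → Set (ProbabilityMeasure Ω),
        Alloc.IsRobustConditionalMean H 𝒬 ∧
        (∀ (i j : Fin n) (S : Alloc.RV P) (G : Alloc.SubSigma Ω), 𝒬 i S G = 𝒬 j S G) ∧
        (∀ (i : Fin n) (S : Alloc.RV P) (G : Alloc.SubSigma Ω),
          𝒬 i S G ⊆ Alloc.compatible P (Alloc.augment G S)) := by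
  constructor
  · rintro ⟨-, hA, hP⟩
    obtain ⟨𝒬, h, h𝒬⟩ := (Alloc.isUtilityBased_of_axioms hn hA hP).exists_isRobustConditionalMean
    exact ⟨fun _ => 𝒬, h, fun _ _ _ _ => rfl, fun _ => h𝒬⟩
  · rintro ⟨𝒬, h, hcommon, hcompat⟩
    let a : Fin n := ⟨0, by omega⟩
    have h𝒬 : 𝒬 = fun _ => 𝒬 a := by
      funext i S G
      exact hcommon i a S G
    rw [h𝒬] at h
    have hU := h.isUtilityBased (by omega) (hcompat a)
    exact ⟨hU.isAllocationMechanism, hU.allocationAxioms, hU.allocationProperties⟩
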